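/- All matroids are finite. A matroid $\mathcal{M}$ on a ground set $E$ is \emph{regular} if it is the column matroid over $\mathbb{R}$ of a totally unimodular integer matrix $A$ with $r$ rows, columns labelled by $E$, and rank $r$ (for some $r\ge 0$); such an $A$ is called a totally unimodular representation of $\mathcal{M}$. For a matrix $A$ of this kind, the lattice of integer flows is $\Lambda(A)=\ker(A)\cap\mathbb{Z}^{E}$ with the bilinear form induced by the dot product on $\mathbb{Z}^{E}$. Two lattices are \emph{isometric} if there is an isomorphism of abelian groups between them that preserves the bilinear forms. For a matroid $\mathcal{M}$, let $\mathcal{M}_\bullet$ be the minor of $\mathcal{M}$ obtained by contracting all co-loops of $\mathcal{M}$. Two matroids are \emph{isomorphic} if there is a bijection between their ground sets that preserves independence in both directions. \textbf{Theorem.} Let $\mathcal{M}$ and $\mathcal{N}$ be regular matroids. For any totally unimodular representation $A$ of $\mathcal{M}$ and any totally unimodular representation $B$ of $\mathcal{N}$, put $\Lambda(\mathcal{M})=\Lambda(A)$ and $\Lambda(\mathcal{N})=\Lambda(B)$. Then $\Lambda(\mathcal{M})$ and $\Lambda(\mathcal{N})$ are isometric if and only if $\mathcal{M}_\bullet$ and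 $\mathcal{N}_\bullet$ are isomorphic. -/

import Mathlib

open scoped Matrix

namespace Matroid

/-- The `r`-by-`E` integer matrix `A` is a totally unimodular matrix of rank `r` whose column
matroid over `ℝ` is `M` (the columns are labelled by the ground set `E` of `M`). -/
structure IsTURepresentation {α : Type*} (M : Matroid α) [Fintype M.E] {r : ℕ}
    (A : Matrix (Fin r) M.E ℤ) : Prop where
  isTotallyUnimodular : A.IsTotallyUnimodular
  rank_eq : (A.map (Int.cast : ℤ → ℝ)).rank = r
  indep_iff : ∀ I : Set M.E, M.Indep (Subtype.val '' I) ↔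
    LinearIndepOn ℝ (fun e : M.E => (A.map (Int.cast : ℤ → ℝ)).col e) I

/-- A finite matroid is regular if it is the column matroid over `ℝ` of some totally unimodular
`r`-by-`E` matrix of rank `r`. -/
def IsRegular {α : Type*} (M : Matroid α) [Fintype M.E] : Prop :=
  ∃ (r : ℕ) (A : Matrix (Fin r) M.E ℤ), M.IsTURepresentation A

/-- The minor of `M` obtained by contracting all coloops. -/
def contractColoops {α : Type*} (M : Matroid α) : Matroid α :=
  M.contract M.coloops

/-- Two matroids are isomorphic if there is a bijection between their ground sets which
preserves independence in both directions. -/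
def IsIsomorphic {α β : Type*} (M : Matroid α) (N : Matroid β) : Prop :=
  ∃ φ : M.E ≃ N.E, ∀ I : Set M.E,
    M.Indep (Subtype.val '' I) ↔ N.Indep (Subtype.val '' (φ '' I))

end Matroid

/-- The lattice of integer flows `ker(A) ∩ ℤ^E` of an integer matrix `A` with columns labelled
by `E`. It carries the restriction of the dot product of `ℤ^E`. -/
def integerFlows {m E : Type*} [Fintype E] (A : Matrix m E ℤ) : AddSubgroup (E → ℤ) where
  carrier := {x | A *ᵥ x = 0}
  zero_mem' := Matrix.mulVec_zero A
  add_mem' := by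
    intro x y hx hy
    simp only [Set.mem_ofPred_eq] at hx hy ⊢
    rw [Matrix.mulVec_add, hx, hy, add_zero]
  neg_mem' := by
    intro x hx
    simp only [Set.mem_ofPred_eq] at hx ⊢
    rw [Matrix.mulVec_neg, hx, neg_zero]

/-- Two lattices `Λ ⊆ ℤ^E` and `Λ' ⊆ ℤ^F`, with the bilinear forms induced by the dot products,
are isometric if there is an isomorphism of abelian groups `Λ ≃ Λ'` preserving these forms. -/
def LatticesIsometric {E F : Type*} [Fintype E] [Fintype F]
    (L : AddSubgroup (E → ℤ)) (L' : AddSubgroup (F → ℤ)) : Prop :=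
  ∃ ψ : L ≃+ L', ∀ x y : L, (ψ x : F → ℤ) ⬝ᵥ (ψ y : F → ℤ) = (x : E → ℤ) ⬝ᵥ (y : E → ℤ)

/-! Total unimodularity enters only through `IsRegularLattice`, proved by taking a flow of minimal
support and applying Cramer's rule. The rest is about regular lattices, where both directions of
`IsRegularLattice.latticesIsometric_iff` rest on a rigidity statement.

From the form to the matroid: peeling off `{0, 1, -1}`-vectors shows that the `ℓ¹` norm of `x` is
the minimum of `∑ c ⬝ᵥ c` over all decompositions `x = ∑ c` in the lattice, so isometries preserve
it. This norm is the sum of the absolute values of the coordinate functionals, each zero or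
primitive. It bends exactly along the kernels of the nonzero ones, and the size of a bend counts the
functionals with that kernel. Hence these functionals are recovered up to sign, with multiplicity
(`AddMonoidHom.exists_equiv_of_sum_abs_eq`). The resulting bijection of coordinates preserves zero
patterns, hence independence.

From the matroid to the form: this is unique representability of regular matroids. Relative to a
maximal independent set the lattice has a fundamental basis of `{0, 1, -1}`-vectors whose supports
depend on independence alone. The signs are unique up to rescaling vectors and coordinates, because
regularity fixes the product of the signs around a chordless cycle (`IsRegularFamily.exists_units`).
Sign changes of coordinates are isometries.

Finally, the coordinates on which all flows vanish are the coloops. They contribute nothing to the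
form, and contracting them removes them from the matroid. -/

/-- A sublattice of `ℤ^E` such that every nonzero element dominates, coordinatewise and with
matching signs, a nonzero lattice vector with entries in `{0, 1, -1}`. -/
def IsRegularLattice {E : Type*} (L : AddSubgroup (E → ℤ)) : Prop :=
  ∀ x ∈ L, x ≠ 0 → ∃ c ∈ L, c ≠ 0 ∧ ∀ e, c e = 0 ∨ c e = (x e).sign

/-- A set of coordinates which supports no nonzero lattice vector. -/
def FlowIndep {E : Type*} (L : AddSubgroup (E → ℤ)) (I : Set E) : Prop :=
  ∀ x ∈ L, (∀ e, e ∉ I → x e = 0) → x = 0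

/-! ### Independence of integral columns over `ℤ` and over `ℝ` -/

theorem mem_integerFlows {m E : Type*} [Fintype E] {A : Matrix m E ℤ} {x : E → ℤ} :
    x ∈ integerFlows A ↔ A *ᵥ x = 0 := Iff.rfl

theorem Fintype.sum_eq_sum_subtype_of_eq_zero {E R : Type*} [Fintype E] [AddCommMonoid R]
    {p : E → Prop} [DecidablePred p] (f : E → R) (hf : ∀ e, ¬ p e → f e = 0) :
    ∑ e, f e = ∑ e : {e // p e}, f e := by
  rw [← Finset.sum_subtype (Finset.univ.filter p) (by simp) f]
  exact (Finset.sum_filter_of_ne fun e _ h => by_contra fun hp => h (hf e hp)).symm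

/-- Rows forming a basis of the row space are as many as the columns, since row rank equals column
rank. -/
theorem Matrix.exists_submatrix_det_ne_zero {K m n : Type*} [Field K] [Finite m] [Fintype n]
    [DecidableEq n] (A : Matrix m n K) (hA : LinearIndependent K A.col) :
    ∃ f : n → m, (A.submatrix f id).det ≠ 0 := by
  cases nonempty_fintype m
  obtain ⟨κ, a, -, hsp, hli⟩ := exists_linearIndependent' K A.row
  have hrk : Module.finrank K (Submodule.span K (Set.range A.row)) = Fintype.card n := by
    rw [← Matrix.rank_eq_finrank_span_row, ← Matrix.rank_transpose]
    exact LinearIndependent.rank_matrix (M := Aᵀ) hA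
  have : Fintype κ := @Fintype.ofFinite κ (hli.finite)
  have hcard : Fintype.card κ = Fintype.card n := by
    rw [← hrk, ← hsp, finrank_span_eq_card hli]
  let e : n ≃ κ := (Fintype.equivOfCardEq hcard).symm
  refine ⟨a ∘ e, ?_⟩
  have h2 : LinearIndependent K (A.submatrix (a ∘ e) id).row :=
    hli.comp e e.injective
  exact ((Matrix.isUnit_iff_isUnit_det _).1 (Matrix.linearIndependent_rows_iff_isUnit.1 h2)).ne_zero

theorem Matrix.exists_submatrix_det_ne_zero_int {m n : Type*} [Finite m] [Fintype n]
    [DecidableEq n] (A : Matrix m n ℤ) (hA : ∀ z, A *ᵥ z = 0 → z = 0) :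
    ∃ f : n → m, (A.submatrix f id).det ≠ 0 := by
  have hZ : LinearIndependent ℤ (A.map (Int.cast : ℤ → ℚ)).col := by
    rw [Fintype.linearIndependent_iff]
    intro g hg
    refine congrFun (hA g ?_)
    ext i
    have := congrFun hg i
    simp only [Finset.sum_apply, zsmul_eq_mul, Pi.zero_apply] at this
    simp only [Matrix.mulVec, dotProduct, Pi.zero_apply]
    have h : ((∑ j, g j * A i j : ℤ) : ℚ) = 0 := by push_cast; exact this
    rw [Int.cast_eq_zero] at h
    simpa [mul_comm] using h
  obtain ⟨f, hf⟩ := Matrix.exists_submatrix_det_ne_zero _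
    ((LinearIndependent.iff_fractionRing ℤ ℚ).1 hZ)
  refine ⟨f, fun h => hf ?_⟩
  have := Int.cast_det (R := ℚ) (A.submatrix f id)
  rw [h, Int.cast_zero] at this
  exact this.symm

/-- Integral column vectors are independent over `ℝ` as soon as they are over `ℤ`. -/
theorem linearIndepOn_real_iff_flowIndep {m E : Type*} [Finite m] [Fintype E] (A : Matrix m E ℤ)
    (I : Set E) :
    LinearIndepOn ℝ (fun e => (A.map (Int.cast : ℤ → ℝ)).col e) I ↔
      FlowIndep (integerFlows A) I := by
  classical
  have key : ∀ z : I → ℤ, A *ᵥ (fun e => if h : e ∈ I then z ⟨e, h⟩ else 0) =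
      A.submatrix id (Subtype.val : I → E) *ᵥ z := by
    intro z
    ext i
    simp only [Matrix.mulVec, dotProduct, Matrix.submatrix_apply, id]
    rw [Fintype.sum_eq_sum_subtype_of_eq_zero (p := (· ∈ I)) _ fun e he => by simp [he]]
    exact Finset.sum_congr rfl fun e _ => by simp
  constructor
  · intro h x hx hxI
    have h1 : LinearIndependent ℝ (fun e : I => (A.map (Int.cast : ℤ → ℝ)).col e) := h
    rw [Fintype.linearIndependent_iff] at h1
    have := h1 (fun e => x e) ?_
    · ext e
      by_cases he : e ∈ I
      · simpa using this ⟨e, he⟩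
      · exact hxI e he
    · have hk := key (fun e => x e)
      have hxx : (fun e => if h : e ∈ I then x e else 0) = x := by
        ext e
        by_cases he : e ∈ I
        · simp [he]
        · simp [he, hxI e he]
      rw [hxx, mem_integerFlows.1 hx] at hk
      ext i
      have := congrArg (Int.cast : ℤ → ℝ) (congrFun hk i)
      simp only [Matrix.mulVec, dotProduct, Matrix.submatrix_apply, id, Pi.zero_apply] at this
      push_cast at this
      simp only [Finset.sum_apply, Pi.smul_apply, Matrix.col_apply, Matrix.map_apply, smul_eq_mul,
        Pi.zero_apply]
      simpa [mul_comm] using this.symm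
  · intro h
    -- A nonzero integral minor stays nonzero over `ℝ`, and independence of the truncated columns
    -- lifts to the full ones.
    obtain ⟨f, hf⟩ := Matrix.exists_submatrix_det_ne_zero_int
      (A.submatrix id (Subtype.val : I → E)) (by
        intro z hz
        rw [← key] at hz
        have := h _ hz (by intro e he; simp [he])
        ext e
        have := congrFun this e
        simpa using this)
    have hf' : ((A.map (Int.cast : ℤ → ℝ)).submatrix f (Subtype.val : I → E)).det ≠ 0 := by
      have := Int.cast_det (R := ℝ) ((A.submatrix id (Subtype.val : I → E)).submatrix f id)
      intro h0
      apply hf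
      have h2 : (((A.submatrix id (Subtype.val : I → E)).submatrix f id).det : ℝ) = 0 := by
        rw [this]; exact h0
      exact_mod_cast h2
    have h3 := Matrix.linearIndependent_cols_of_det_ne_zero hf'
    show LinearIndependent ℝ (fun e : I => (A.map (Int.cast : ℤ → ℝ)).col e)
    exact LinearIndependent.of_comp (LinearMap.funLeft ℝ ℝ f) h3

/-! ### Flow lattices of totally unimodular matrices are regular -/

/-- If all flows supported in the support of the flow `y` of a totally unimodular matrix have the
same support as `y`, then the entries of `y` have constant absolute value. -/
theorem Matrix.IsTotallyUnimodular.natAbs_eq_of_minimal_support {m E : Type*} [Finite m] [Fintype E]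
    {A : Matrix m E ℤ} (hA : A.IsTotallyUnimodular) {y : E → ℤ} (hy : y ∈ integerFlows A)
    (hmin : ∀ z ∈ integerFlows A, (∀ e, y e = 0 → z e = 0) → (∃ e, y e ≠ 0 ∧ z e = 0) → z = 0)
    {e e₀ : E} (he : y e ≠ 0) (he₀ : y e₀ ≠ 0) : (y e).natAbs = (y e₀).natAbs := by
  classical
  by_cases hee : e = e₀
  · rw [hee]
  let S := {e : E // y e ≠ 0 ∧ e ≠ e₀}
  have key : ∀ (i : m) (z : E → ℤ), (∀ e, y e = 0 → z e = 0) →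
      (A *ᵥ z) i = A i e₀ * z e₀ + ∑ s : S, A i s * z s := by
    intro i z hz
    simp only [Matrix.mulVec, dotProduct]
    rw [← sub_eq_iff_eq_add', ← Finset.sum_erase_eq_sub (Finset.mem_univ e₀),
      ← Finset.sum_filter_of_ne (p := fun e => y e ≠ 0 ∧ e ≠ e₀)]
    · exact Finset.sum_subtype (p := fun e => y e ≠ 0 ∧ e ≠ e₀) _
        (fun e => by simp only [Finset.mem_filter, Finset.mem_erase, Finset.mem_univ]; tauto)
        (fun e => A i e * z e)
    · exact fun e he h => ⟨fun h0 => h (by rw [hz e h0, mul_zero]), Finset.ne_of_mem_erase he⟩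
  -- A relation among the columns in `S` is a flow supported in the support of `y` and vanishing at
  -- `e₀`, so it is zero by minimality.
  obtain ⟨f, hf⟩ := Matrix.exists_submatrix_det_ne_zero_int
    (A.submatrix id (Subtype.val : S → E)) (by
      intro z hz
      let z' : E → ℤ := fun e => if h : y e ≠ 0 ∧ e ≠ e₀ then z ⟨e, h⟩ else 0
      have hz' : z' = 0 := by
        refine hmin z' ?_ (fun e he => by simp [z', he]) ⟨e₀, he₀, by simp [z']⟩
        rw [mem_integerFlows]
        ext i
        rw [key i z' (fun e he => by simp [z', he])]
        have := congrFun hz i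
        simp only [Matrix.mulVec, dotProduct, Matrix.submatrix_apply, id, Pi.zero_apply] at this
        have h0 : z' e₀ = 0 := by simp [z']
        rw [h0, mul_zero, zero_add]
        refine Eq.trans ?_ this
        refine Finset.sum_congr rfl fun s _ => ?_
        simp only [z', dif_pos s.2]
        rfl
      ext s
      have := congrFun hz' s
      simp only [z', dif_pos s.2] at this
      exact this)
  let B := A.submatrix f (Subtype.val : S → E)
  let b : S → ℤ := fun s => A (f s) e₀
  have hB : B *ᵥ (fun s => y s) = (-y e₀) • b := by
    ext s
    have := congrFun (mem_integerFlows.1 hy) (f s)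
    rw [key (f s) y (fun e he => he)] at this
    simp only [Matrix.mulVec, dotProduct, B, Matrix.submatrix_apply, b, Pi.smul_apply, smul_eq_mul]
    simp only [Pi.zero_apply] at this
    linarith
  -- Cramer's rule: `B.det` is `± 1` and the entries of `B.cramer b` are minors of `A`, hence in
  -- `{0, 1, -1}`, so each nonzero `y e` is `± y e₀`.
  have hC : B.det • (fun s : S => y s) = (-y e₀) • B.cramer b := by
    rw [← LinearMap.map_smul, ← hB, Matrix.cramer_eq_adjugate_mulVec, Matrix.mulVec_mulVec,
      Matrix.adjugate_mul, Matrix.smul_mulVec, Matrix.one_mulVec]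
  have h1 : B.det.natAbs = 1 := by
    obtain ⟨t, ht⟩ := (Matrix.isTotallyUnimodular_iff_fintype A).1 hA S f Subtype.val
    have hf : (A.submatrix f (Subtype.val : S → E)).det ≠ 0 := hf
    change (A.submatrix f (Subtype.val : S → E)).det.natAbs = 1
    rw [← ht] at hf ⊢
    cases t <;> simp at hf ⊢
  have h2 := congrFun hC ⟨e, he, hee⟩
  have h3 : (B.cramer b ⟨e, he, hee⟩) ∈ Set.range SignType.cast := by
    have := (Matrix.isTotallyUnimodular_iff_fintype A).1 hA S f
      (Function.update Subtype.val ⟨e, he, hee⟩ e₀)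
    rw [Matrix.cramer_apply]
    convert this using 2
    ext i j
    by_cases hj : j = ⟨e, he, hee⟩
    · subst hj; simp [b]
    · simp [hj, B]
  simp only [Pi.smul_apply, smul_eq_mul] at h2
  have h4 := congrArg Int.natAbs h2
  rw [Int.natAbs_mul, h1, one_mul, Int.natAbs_mul, Int.natAbs_neg] at h4
  obtain ⟨t, ht⟩ := h3
  rw [← ht] at h4 h2
  cases t <;> simp_all

/-- Eliminating a coordinate in which the ratio `z e / y e` is maximal keeps the signs of `y`. -/
theorem exists_conformal_elimination {E : Type*} [Finite E] {y z : E → ℤ} (hz : z ≠ 0)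
    (hsupp : ∀ e, y e = 0 → z e = 0) :
    ∃ a b : ℤ, 0 < a ∧ (∃ e, y e ≠ 0 ∧ a * y e + b * z e = 0) ∧
      ∀ e, 0 ≤ (a * y e + b * z e) * y e := by
  obtain ⟨e₂, he₂⟩ := Function.ne_iff.1 hz
  have : Nonempty E := ⟨e₂⟩
  -- Where `y e = 0` the quotient is `0` by convention, which is harmless because `z e = 0` there as
  -- well.
  obtain ⟨e₁, he₁⟩ := Finite.exists_max fun e => ((|z e| : ℤ) : ℚ) / (|y e| : ℤ)
  have hpos : (0 : ℚ) < (|z e₁| : ℤ) / (|y e₁| : ℤ) := by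
    refine lt_of_lt_of_le (div_pos ?_ ?_) (he₁ e₂)
    · exact_mod_cast abs_pos.2 he₂
    · exact_mod_cast abs_pos.2 fun h => he₂ (hsupp _ h)
  have hz₁ : z e₁ ≠ 0 := by rintro h; simp [h] at hpos
  have hy₁ : y e₁ ≠ 0 := by rintro h; simp [h] at hpos
  refine ⟨|z e₁|, -((z e₁).sign * y e₁), abs_pos.2 hz₁, ⟨e₁, hy₁, ?_⟩, fun e => ?_⟩
  · have := Int.sign_mul_self_eq_abs (z e₁)
    linear_combination -(y e₁) * this
  · by_cases hye : y e = 0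
    · simp [hye]
    have h := he₁ e
    rw [div_le_div_iff₀ (by exact_mod_cast abs_pos.2 hye) (by exact_mod_cast abs_pos.2 hy₁)] at h
    have h' : |z e| * |y e₁| ≤ |z e₁| * |y e| := by exact_mod_cast h
    have hs : |(z e₁).sign| = 1 := by
      rcases hz₁.lt_or_gt with h | h
      · simp [Int.sign_eq_neg_one_of_neg h]
      · simp [Int.sign_eq_one_of_pos h]
    have h1 : |(z e₁).sign * y e₁ * z e * y e| ≤ |z e₁| * |y e| * |y e| := by
      rw [abs_mul, abs_mul, abs_mul, hs, one_mul, mul_comm |y e₁|]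
      exact mul_le_mul_of_nonneg_right h' (abs_nonneg _)
    have h2 := (abs_le.1 h1).2
    rw [mul_assoc |z e₁|, abs_mul_abs_self] at h2
    linarith

/-- Take `y` of minimal support among the nonzero flows conformal to `x`. Conformal elimination
shows that no nonzero flow whatsoever has strictly smaller support inside that of `y`. Hence the
entries of `y` share one absolute value, and dividing by it gives the required vector. -/
theorem Matrix.IsTotallyUnimodular.isRegularLattice {m E : Type*} [Finite m] [Fintype E]
    {A : Matrix m E ℤ} (hA : A.IsTotallyUnimodular) : IsRegularLattice (integerFlows A) := by
  classical
  intro x hx hx0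
  let T : Set (E → ℤ) := {y | y ∈ integerFlows A ∧ y ≠ 0 ∧ ∀ e, y e = 0 ∨ 0 < y e * x e}
  obtain ⟨y, ⟨hyL, hy0, hyx⟩, hymin⟩ := exists_minimalFor_of_wellFoundedLT (· ∈ T)
    (fun y => (Finset.univ.filter (fun e => y e ≠ 0)).card)
    ⟨x, hx, hx0, fun e => (eq_or_ne (x e) 0).imp id fun h => mul_self_pos.2 h⟩
  have hmin : ∀ z ∈ integerFlows A, (∀ e, y e = 0 → z e = 0) →
      (∃ e, y e ≠ 0 ∧ z e = 0) → z = 0 := by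
    rintro z hzL hzy ⟨e, hye, hze⟩
    by_contra hz0
    obtain ⟨a, b, ha, ⟨e₁, he₁, h0⟩, hs⟩ := exists_conformal_elimination hz0 hzy
    let w := a • y + b • z
    have hw : ∀ e, w e = a * y e + b * z e := fun e => by simp [w]
    have hwT : w ∈ T := by
      refine ⟨add_mem (zsmul_mem hyL _) (zsmul_mem hzL _), fun h => ?_, fun f => ?_⟩
      · have := congrFun h e
        rw [hw, hze] at this
        simp at this
        omega
      · by_cases hwf : w f = 0
        · exact Or.inl hwf
        right
        have hyf : y f ≠ 0 := fun h => hwf (by rw [hw, h, hzy f h]; ring)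
        have h1 := hs f
        rw [← hw] at h1
        have h2 : 0 < w f * y f := lt_of_le_of_ne h1 (mul_ne_zero hwf hyf).symm
        have h3 := (hyx f).resolve_left hyf
        have h4 : 0 < (w f * x f) * (y f * y f) := by
          have := mul_pos h2 h3
          linarith [this, show w f * y f * (y f * x f) = (w f * x f) * (y f * y f) by ring]
        exact (pos_iff_pos_of_mul_pos h4).2 (mul_self_pos.2 hyf)
    have hlt : (Finset.univ.filter (fun e => w e ≠ 0)).card <
        (Finset.univ.filter (fun e => y e ≠ 0)).card := by
      apply Finset.card_lt_card
      rw [Finset.ssubset_iff_of_subset]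
      · exact ⟨e₁, by simp [he₁], by simp [hw, h0]⟩
      · intro f
        simp only [Finset.mem_filter, Finset.mem_univ, true_and]
        intro h h'
        exact h (by rw [hw, h', hzy f h']; ring)
    exact absurd (hymin hwT hlt.le) (by simpa using hlt)
  obtain ⟨e₀, he₀⟩ := Function.ne_iff.1 hy0
  have habs := fun e (he : y e ≠ 0) => hA.natAbs_eq_of_minimal_support hyL hmin he he₀
  have hsign : ∀ e, y e = ((y e₀).natAbs : ℤ) * (y e).sign := by
    intro e
    by_cases he : y e = 0
    · simp [he]
    · rw [← habs e he, mul_comm, Int.sign_mul_natAbs]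
  refine ⟨fun e => (y e).sign, ?_, ?_, ?_⟩
  · rw [mem_integerFlows] at hyL ⊢
    have h : y = ((y e₀).natAbs : ℤ) • (fun e => (y e).sign) := funext hsign
    rw [h, Matrix.mulVec_smul, smul_eq_zero] at hyL
    exact hyL.resolve_left (by simpa using he₀)
  · intro h
    have := congrFun h e₀
    simp at this
    exact he₀ this
  · intro e
    refine (hyx e).imp (fun h => by simp [h]) fun h => ?_
    show (y e).sign = (x e).sign
    rcases pos_and_pos_or_neg_and_neg_of_mul_pos h with ⟨h1, h2⟩ | ⟨h1, h2⟩
    · rw [Int.sign_eq_one_of_pos h1, Int.sign_eq_one_of_pos h2]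
    · rw [Int.sign_eq_neg_one_of_neg h1, Int.sign_eq_neg_one_of_neg h2]

/-! ### Recovering primitive functionals from the sum of their absolute values -/

section FunctionalsFromNorm

/-- Induction: to a point good for all but one functional, taken with a multiple too large to be
cancelled, add a point good for the last one. -/
theorem AddMonoidHom.exists_mem_forall_ne_zero {G : Type*} [AddCommGroup G] (K : AddSubgroup G)
    (s : Finset (G →+ ℤ)) (hs : ∀ n ∈ s, ∃ x ∈ K, n x ≠ 0) : ∃ p ∈ K, ∀ n ∈ s, n p ≠ 0 := by
  classical
  induction s using Finset.induction_on with
  | empty => exact ⟨0, K.zero_mem, by simp⟩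
  | insert n s hn ih =>
    obtain ⟨p, hpK, hp⟩ := ih fun k hk => hs k (Finset.mem_insert_of_mem hk)
    obtain ⟨x, hxK, hx⟩ := hs n (Finset.mem_insert_self _ _)
    by_cases hnp : n p = 0
    · refine ⟨(1 + ∑ k ∈ s, |k x|) • p + x, add_mem (zsmul_mem hpK _) hxK, fun k hk => ?_⟩
      rw [map_add, map_zsmul, smul_eq_mul]
      rcases Finset.mem_insert.1 hk with rfl | hk
      · simpa [hnp] using hx
      · intro h
        have h1 : |k x| ≤ ∑ k ∈ s, |k x| :=
          Finset.single_le_sum (f := fun k : G →+ ℤ => |k x|) (fun _ _ => abs_nonneg _) hk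
        have h2 : |k x| = (1 + ∑ k ∈ s, |k x|) * |k p| := by
          rw [eq_neg_of_add_eq_zero_right h, abs_neg, abs_mul, abs_of_nonneg]
          exact add_nonneg zero_le_one (Finset.sum_nonneg fun _ _ => abs_nonneg _)
        have h3 : 0 < |k p| := abs_pos.2 (hp k hk)
        have h4 := abs_nonneg (k x)
        nlinarith
    · refine ⟨p, hpK, fun k hk => ?_⟩
      rcases Finset.mem_insert.1 hk with rfl | hk
      · exact hnp
      · exact hp k hk

/-- A primitive functional which vanishes on the kernel of `l`, where `l v = 1`, is `± l`. -/
theorem AddMonoidHom.eq_or_eq_neg_of_forall_ker {G : Type*} [AddCommGroup G] {l n : G →+ ℤ} {v : G}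
    (hv : l v = 1) (hn : ∃ u, n u = 1) (h : ∀ x ∈ l.ker, n x = 0) : n = l ∨ n = -l := by
  have key : ∀ x, n x = n v * l x := by
    intro x
    have := h (x - l x • v) (by simp [AddMonoidHom.mem_ker, hv])
    rw [map_sub, map_zsmul, smul_eq_mul] at this
    linarith
  obtain ⟨u, hu⟩ := hn
  rw [key u] at hu
  rcases Int.isUnit_iff.1 (IsUnit.of_mul_eq_one _ hu) with h1 | h1
  · left; ext x; rw [key, h1, one_mul]
  · right; ext x; rw [key, h1]; simp

theorem Int.abs_add_add_abs_sub_of_abs_le {a b : ℤ} (h : |b| ≤ |a|) :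
    |a + b| + |a - b| = 2 * |a| := by
  grind

/-- The second difference of `∑ |l e|` at a generic point of a hyperplane counts the functionals
defining this hyperplane. -/
theorem AddMonoidHom.sum_second_difference {G E : Type*} [AddCommGroup G] [Fintype E]
    [DecidableEq (G →+ ℤ)] (l : E → G →+ ℤ) {n : G →+ ℤ} {v q : G} (hv : n v = 1) (hq : n q = 0)
    (h : ∀ e, l e = 0 ∨ l e = n ∨ l e = -n ∨ |l e v| ≤ |l e q|) :
    (∑ e, |l e (q + v)|) + (∑ e, |l e (q - v)|) =
      2 * (∑ e, |l e q|) + 2 * (Finset.univ.filter fun e => l e = n ∨ l e = -n).card := by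
  rw [Finset.card_filter, Nat.cast_sum, Finset.mul_sum, Finset.mul_sum, ← Finset.sum_add_distrib,
    ← Finset.sum_add_distrib]
  refine Finset.sum_congr rfl fun e _ => ?_
  by_cases h1 : l e = n ∨ l e = -n
  · rcases h1 with h1 | h1 <;> simp [h1, hv, hq]
  · rw [if_neg h1]
    rcases h e with h0 | h2 | h2 | h2
    · simp [h0]
    · exact absurd (Or.inl h2) h1
    · exact absurd (Or.inr h2) h1
    · rw [map_add, map_sub, Int.abs_add_add_abs_sub_of_abs_le h2]; simp

/-- At a point of `n.ker` far from the kernels of all other functionals, a step by `± v` moves no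
other value across zero. The second difference of the sum then sees only `n` and `-n`. -/
theorem AddMonoidHom.card_eq_of_sum_abs_eq {G E F : Type*} [AddCommGroup G] [Fintype E] [Fintype F]
    [DecidableEq (G →+ ℤ)] (l : E → G →+ ℤ) (m : F → G →+ ℤ)
    (hl : ∀ e, l e ≠ 0 → ∃ v, l e v = 1) (hm : ∀ f, m f ≠ 0 → ∃ v, m f v = 1)
    (h : ∀ x, ∑ e, |l e x| = ∑ f, |m f x|) {n : G →+ ℤ} {v : G} (hv : n v = 1) :
    (Finset.univ.filter fun e => l e = n ∨ l e = -n).card =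
      (Finset.univ.filter fun f => m f = n ∨ m f = -n).card := by
  let s : Finset (G →+ ℤ) := ((Finset.univ.image l) ∪ (Finset.univ.image m)).filter
    fun k => k ≠ 0 ∧ k ≠ n ∧ k ≠ -n
  obtain ⟨p, hpK, hp⟩ := AddMonoidHom.exists_mem_forall_ne_zero n.ker s (by
    intro k hk
    by_contra! hcon
    simp only [s, Finset.mem_filter, Finset.mem_union, Finset.mem_image, Finset.mem_univ,
      true_and] at hk
    obtain ⟨hk, hk0, hk1, hk2⟩ := hk
    have hku : ∃ u, k u = 1 := by
      rcases hk with ⟨e, rfl⟩ | ⟨e, rfl⟩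
      · exact hl e hk0
      · exact hm e hk0
    exact (AddMonoidHom.eq_or_eq_neg_of_forall_ker hv hku hcon).elim hk1 hk2)
  let N : ℤ := ∑ k ∈ s, |k v|
  have hN : 0 ≤ N := Finset.sum_nonneg fun _ _ => abs_nonneg _
  have hlarge : ∀ k ∈ s, |k v| ≤ |k (N • p)| := by
    intro k hk
    rw [map_zsmul, smul_eq_mul, abs_mul, abs_of_nonneg hN]
    have h1 : |k v| ≤ N :=
      Finset.single_le_sum (f := fun k : G →+ ℤ => |k v|) (fun _ _ => abs_nonneg _) hk
    have h2 : 0 < |k p| := abs_pos.2 (hp k hk)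
    nlinarith
  have hq : n (N • p) = 0 := by
    rw [map_zsmul, AddMonoidHom.mem_ker.1 hpK, smul_zero]
  have h1 := AddMonoidHom.sum_second_difference l hv hq (fun e => by
    by_contra! hcon
    exact absurd (hlarge (l e) (by simp [s, hcon.1, hcon.2.1, hcon.2.2.1])) hcon.2.2.2.not_ge)
  have h2 := AddMonoidHom.sum_second_difference m hv hq (fun e => by
    by_contra! hcon
    exact absurd (hlarge (m e) (by simp [s, hcon.1, hcon.2.1, hcon.2.2.1])) hcon.2.2.2.not_ge)
  rw [h, h, h] at h1
  have h3 := h1.symm.trans h2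
  have h4 : ((Finset.univ.filter fun e => l e = n ∨ l e = -n).card : ℤ) =
      (Finset.univ.filter fun f => m f = n ∨ m f = -n).card := by linarith
  exact_mod_cast h4

/-- The nonzero members of a finite family of primitive integral functionals are determined, up to
signs, by the sum of the absolute values. -/
theorem AddMonoidHom.exists_equiv_of_sum_abs_eq {G E F : Type*} [AddCommGroup G] [Fintype E]
    [Fintype F] (l : E → G →+ ℤ) (m : F → G →+ ℤ)
    (hl : ∀ e, l e ≠ 0 → ∃ v, l e v = 1) (hm : ∀ f, m f ≠ 0 → ∃ v, m f v = 1)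
    (h : ∀ x, ∑ e, |l e x| = ∑ f, |m f x|) :
    ∃ φ : {e // l e ≠ 0} ≃ {f // m f ≠ 0}, ∀ e, m (φ e) = l e ∨ m (φ e) = -l e := by
  classical
  -- The unordered pair `{l, -l}` labels a functional up to sign; the bijection is assembled from
  -- bijections between the fibres of this label.
  let κ : {e // l e ≠ 0} → Sym2 (G →+ ℤ) := fun e => s(l e, -l e)
  let κ' : {f // m f ≠ 0} → Sym2 (G →+ ℤ) := fun f => s(m f, -m f)
  have hs : ∀ a b : G →+ ℤ, s(a, -a) = s(b, -b) ↔ a = b ∨ a = -b := by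
    intro a b
    rw [Sym2.eq_iff]
    constructor
    · rintro (h | h)
      · exact Or.inl h.1
      · exact Or.inr h.1
    · rintro (rfl | rfl)
      · simp
      · simp
  have hfib : ∀ c, Nonempty ({e // κ e = c} ≃ {f // κ' f = c}) := by
    intro c
    by_cases hc : ∃ (n : G →+ ℤ) (v : G), n v = 1 ∧ c = s(n, -n)
    · obtain ⟨n, v, hv, rfl⟩ := hc
      have hn : n ≠ 0 := by rintro rfl; simp at hv
      have hcard := AddMonoidHom.card_eq_of_sum_abs_eq l m hl hm h hv
      rw [← Fintype.card_subtype, ← Fintype.card_subtype] at hcard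
      have e0 := Fintype.equivOfCardEq hcard
      refine ⟨Equiv.trans (Equiv.trans ?_ e0) (Equiv.symm ?_)⟩
      · exact (Equiv.subtypeSubtypeEquivSubtypeInter _ (fun e => s(l e, -l e) = s(n, -n))).trans
          (Equiv.subtypeEquivRight fun e => by
            rw [hs]
            exact ⟨And.right, fun h => ⟨by rcases h with h | h <;> simp [h, hn], h⟩⟩)
      · exact (Equiv.subtypeSubtypeEquivSubtypeInter _ (fun e => s(m e, -m e) = s(n, -n))).trans
          (Equiv.subtypeEquivRight fun e => by
            rw [hs]
            exact ⟨And.right, fun h => ⟨by rcases h with h | h <;> simp [h, hn], h⟩⟩)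
    · have h1 : IsEmpty {e // κ e = c} := ⟨by
        rintro ⟨e, he⟩
        obtain ⟨v, hv⟩ := hl e e.2
        exact hc ⟨l e, v, hv, he.symm⟩⟩
      have h2 : IsEmpty {e // κ' e = c} := ⟨by
        rintro ⟨e, he⟩
        obtain ⟨v, hv⟩ := hm e e.2
        exact hc ⟨m e, v, hv, he.symm⟩⟩
      exact ⟨Equiv.equivOfIsEmpty _ _⟩
  refine ⟨Equiv.ofFiberEquiv (f := κ) (g := κ') fun c => (hfib c).some, fun e => ?_⟩
  exact (hs _ _).1 (Equiv.ofFiberEquiv_map (f := κ) (g := κ') (fun c => (hfib c).some) e)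

end FunctionalsFromNorm

/-! ### The `ℓ¹` norm is determined by the bilinear form -/

section NormFromForm

variable {E F : Type*} [Fintype E] [Fintype F]

theorem sum_abs_le_dotProduct_self (x : E → ℤ) : ∑ e, |x e| ≤ x ⬝ᵥ x := by
  refine Finset.sum_le_sum fun e _ => ?_
  rcases eq_or_ne (x e) 0 with h | h
  · simp [h]
  · have := Int.one_le_abs h
    rw [← abs_mul_abs_self]
    nlinarith

/-- Subtracting a conformal `{0, 1, -1}`-vector `c` lowers the `ℓ¹` norm by exactly `c ⬝ᵥ c`, so
induction on the norm applies. -/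
theorem IsRegularLattice.exists_list {L : AddSubgroup (E → ℤ)} (hL : IsRegularLattice L) (x : L) :
    ∃ l : List L, l.sum = x ∧ (∀ c ∈ l, ∀ e, |(c : E → ℤ) e| ≤ 1) ∧
      (l.map fun c : L => (c : E → ℤ) ⬝ᵥ (c : E → ℤ)).sum = ∑ e, |(x : E → ℤ) e| := by
  induction hk : (∑ e, |(x : E → ℤ) e|).toNat using Nat.strong_induction_on generalizing x with
  | _ k ih =>
    by_cases hx : x = 0
    · exact ⟨[], by simp [hx]⟩
    obtain ⟨c, hcL, hc0, hc⟩ := hL x x.2 (by simpa using hx)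
    have hsum : ∑ e, |(x : E → ℤ) e| = c ⬝ᵥ c + ∑ e, |(x : E → ℤ) e - c e| := by
      rw [dotProduct, ← Finset.sum_add_distrib]
      refine Finset.sum_congr rfl fun e _ => ?_
      rcases hc e with h | h
      · simp [h]
      · rcases lt_trichotomy ((x : E → ℤ) e) 0 with h0 | h0 | h0
        · rw [h, Int.sign_eq_neg_one_of_neg h0]; grind
        · simp [h, h0]
        · rw [h, Int.sign_eq_one_of_pos h0]; grind
    have hcpos : 0 < c ⬝ᵥ c := by
      refine lt_of_lt_of_le ?_ (sum_abs_le_dotProduct_self c)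
      obtain ⟨e, he⟩ := Function.ne_iff.1 hc0
      exact Finset.sum_pos' (fun _ _ => abs_nonneg _) ⟨e, Finset.mem_univ _, abs_pos.2 he⟩
    have hnn : 0 ≤ ∑ e, |(x : E → ℤ) e - c e| := Finset.sum_nonneg fun _ _ => abs_nonneg _
    obtain ⟨l, hl, hl1, hl2⟩ := ih _ (by
      rw [← hk]
      exact (Int.toNat_lt_toNat (by rw [hsum]; omega)).2 (by
        show ∑ e, |((x - ⟨c, hcL⟩ : L) : E → ℤ) e| < _
        rw [hsum]
        simp only [AddSubgroup.coe_sub, Pi.sub_apply]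
        omega)) (x - ⟨c, hcL⟩) rfl
    refine ⟨⟨c, hcL⟩ :: l, by simp [hl], ?_, ?_⟩
    · intro d hd e
      rcases List.mem_cons.1 hd with rfl | hd
      · rcases hc e with h | h
        · simp [h]
        · show |c e| ≤ 1
          rw [h]
          rcases lt_trichotomy ((x : E → ℤ) e) 0 with h0 | h0 | h0
          · simp [Int.sign_eq_neg_one_of_neg h0]
          · simp [h0]
          · simp [Int.sign_eq_one_of_pos h0]
      · exact hl1 d hd e
    · simp only [List.map_cons, List.sum_cons, hl2, AddSubgroup.coe_sub, Pi.sub_apply, hsum]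

/-- Some piece of a decomposition of `x` has entry `± 1` at `e`. Thus every nonzero coordinate
functional is primitive. -/
theorem IsRegularLattice.exists_apply_eq_one {L : AddSubgroup (E → ℤ)} (hL : IsRegularLattice L)
    {x : E → ℤ} (hx : x ∈ L) {e : E} (he : x e ≠ 0) : ∃ c ∈ L, c e = 1 := by
  obtain ⟨l, hl, hl1, -⟩ := hL.exists_list ⟨x, hx⟩
  have : ∃ c ∈ l, (c : E → ℤ) e ≠ 0 := by
    by_contra! hcon
    apply he
    have h1 : x = ((l.sum : L) : E → ℤ) := by rw [hl]
    rw [h1]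
    clear hl hl1 h1
    induction l with
    | nil => simp
    | cons c l ih =>
      simp only [List.sum_cons, AddSubgroup.coe_add, Pi.add_apply]
      rw [hcon c (by simp), ih fun d hd => hcon d (by simp [hd]), add_zero]
  obtain ⟨c, hc, hce⟩ := this
  have h1 := hl1 c hc e
  rcases hce.lt_or_gt with h | h
  · exact ⟨-c, neg_mem c.2, by rw [abs_le] at h1; simp; omega⟩
  · exact ⟨c, c.2, by rw [abs_le] at h1; omega⟩

theorem sum_abs_list_sum_le {L : AddSubgroup (E → ℤ)} (l : List L) :
    ∑ e, |((l.sum : L) : E → ℤ) e| ≤ (l.map fun c : L => (c : E → ℤ) ⬝ᵥ (c : E → ℤ)).sum := by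
  induction l with
  | nil => simp
  | cons c l ih =>
    simp only [List.sum_cons, List.map_cons, AddSubgroup.coe_add, Pi.add_apply]
    refine le_trans ?_ (add_le_add (sum_abs_le_dotProduct_self (c : E → ℤ)) ih)
    rw [← Finset.sum_add_distrib]
    exact Finset.sum_le_sum fun _ _ => abs_add_le _ _

/-- An optimal decomposition of `x` is mapped to a decomposition of `ψ x` of the same cost, and by
`sum_abs_list_sum_le` the cost bounds the norm from above. -/
theorem IsRegularLattice.sum_abs_map_le {L : AddSubgroup (E → ℤ)} {L' : AddSubgroup (F → ℤ)}
    (hL : IsRegularLattice L) (ψ : L →+ L')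
    (hψ : ∀ x y : L, (ψ x : F → ℤ) ⬝ᵥ (ψ y : F → ℤ) = (x : E → ℤ) ⬝ᵥ (y : E → ℤ)) (x : L) :
    ∑ f, |(ψ x : F → ℤ) f| ≤ ∑ e, |(x : E → ℤ) e| := by
  obtain ⟨l, rfl, -, hl⟩ := hL.exists_list x
  rw [← hl, map_list_sum]
  refine (sum_abs_list_sum_le _).trans (le_of_eq ?_)
  simp [Function.comp_def, hψ]

/-- An isometry between regular lattices is, up to signs, induced by a bijection between the
coordinates which do not vanish identically. -/
theorem LatticesIsometric.exists_equiv {L : AddSubgroup (E → ℤ)} {L' : AddSubgroup (F → ℤ)}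
    (hL : IsRegularLattice L) (hL' : IsRegularLattice L') (h : LatticesIsometric L L') :
    ∃ (ψ : L ≃+ L') (φ : {e // ∃ x ∈ L, x e ≠ 0} ≃ {f // ∃ x ∈ L', x f ≠ 0}),
      ∀ x e, (ψ x : F → ℤ) (φ e) = 0 ↔ (x : E → ℤ) e = 0 := by
  obtain ⟨ψ, hψ⟩ := h
  have hψ' : ∀ x y : L', (ψ.symm x : E → ℤ) ⬝ᵥ (ψ.symm y : E → ℤ) = (x : F → ℤ) ⬝ᵥ (y : F → ℤ) := by
    intro x y
    rw [← hψ]; simp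
  -- The coordinates of `L'` are pulled back along `ψ`, so that both families live on the same group
  -- `L`.
  let l : E → L →+ ℤ := fun e => (Pi.evalAddMonoidHom (fun _ : E => ℤ) e).comp L.subtype
  let m : F → L →+ ℤ := fun f =>
    ((Pi.evalAddMonoidHom (fun _ : F => ℤ) f).comp L'.subtype).comp ψ.toAddMonoidHom
  have hl0 : ∀ e, l e ≠ 0 ↔ ∃ x ∈ L, x e ≠ 0 := by
    intro e
    rw [Ne, DFunLike.ext_iff]
    push Not
    exact ⟨fun ⟨x, hx⟩ => ⟨x, x.2, hx⟩, fun ⟨x, hx, h⟩ => ⟨⟨x, hx⟩, h⟩⟩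
  have hm0 : ∀ f, m f ≠ 0 ↔ ∃ x ∈ L', x f ≠ 0 := by
    intro e
    rw [Ne, DFunLike.ext_iff]
    push Not
    exact ⟨fun ⟨x, hx⟩ => ⟨ψ x, (ψ x).2, hx⟩,
      fun ⟨x, hx, h⟩ => ⟨ψ.symm ⟨x, hx⟩, by
        show (ψ (ψ.symm ⟨x, hx⟩) : F → ℤ) e ≠ 0
        simpa using h⟩⟩
  obtain ⟨φ, hφ⟩ := AddMonoidHom.exists_equiv_of_sum_abs_eq l m
    (fun e he => by
      obtain ⟨x, hx, hxe⟩ := (hl0 e).1 he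
      obtain ⟨c, hc, hce⟩ := hL.exists_apply_eq_one hx hxe
      exact ⟨⟨c, hc⟩, hce⟩)
    (fun f hf => by
      obtain ⟨x, hx, hxe⟩ := (hm0 f).1 hf
      obtain ⟨c, hc, hce⟩ := hL'.exists_apply_eq_one hx hxe
      exact ⟨ψ.symm ⟨c, hc⟩, by
        show (ψ (ψ.symm ⟨c, hc⟩) : F → ℤ) f = 1
        simpa using hce⟩)
    (fun x => le_antisymm
      (by simpa [l, m] using hL'.sum_abs_map_le ψ.symm.toAddMonoidHom hψ' (ψ x))
      (hL.sum_abs_map_le ψ.toAddMonoidHom hψ x))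
  refine ⟨ψ, ((Equiv.subtypeEquivRight hl0).symm.trans φ).trans (Equiv.subtypeEquivRight hm0),
    fun x e => ?_⟩
  have h1 : (ψ x : F → ℤ) (φ ((Equiv.subtypeEquivRight hl0).symm e)) = (x : E → ℤ) e ∨
      (ψ x : F → ℤ) (φ ((Equiv.subtypeEquivRight hl0).symm e)) = -(x : E → ℤ) e :=
    (hφ ((Equiv.subtypeEquivRight hl0).symm e)).imp (fun h => DFunLike.congr_fun h x)
      fun h => DFunLike.congr_fun h x
  show (ψ x : F → ℤ) (φ ((Equiv.subtypeEquivRight hl0).symm e)) = 0 ↔ _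
  rcases h1 with h1 | h1 <;> simp [h1]

end NormFromForm

/-! ### Shortest paths of a relation -/

section ShortestPath

variable {V : Type*}

theorem Relation.ReflTransGen.exists_seq {r : V → V → Prop} {a b : V}
    (h : Relation.ReflTransGen r a b) :
    ∃ (n : ℕ) (i : ℕ → V), i 0 = a ∧ i n = b ∧ ∀ s < n, r (i s) (i (s + 1)) := by
  classical
  induction h with
  | refl => exact ⟨0, fun _ => a, rfl, rfl, by simp⟩
  | @tail b c _ hbc ih =>
    obtain ⟨n, i, h0, hn, hi⟩ := ih
    refine ⟨n + 1, Function.update i (n + 1) c, by simp [h0], by simp, fun s hs => ?_⟩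
    rcases Nat.lt_succ_iff_lt_or_eq.1 hs with h | rfl
    · rw [Function.update_of_ne (by omega), Function.update_of_ne (by omega)]
      exact hi s h
    · rw [Function.update_of_ne (by omega), Function.update_self, hn]
      exact hbc

/-- If some point of `P` is connected to some point of `Q`, then there is a shortest path from
`P` to `Q`: its interior avoids `P` and `Q`, and it has no shortcuts. -/
theorem Relation.ReflTransGen.exists_shortest {r : V → V → Prop} {P Q : V → Prop} {a b : V}
    (ha : P a) (hb : Q b) (h : Relation.ReflTransGen r a b) :
    ∃ (t : ℕ) (i : ℕ → V), P (i 0) ∧ Q (i t) ∧ (∀ s < t, r (i s) (i (s + 1))) ∧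
      (∀ s, 0 < s → s ≤ t → ¬ P (i s)) ∧ (∀ s < t, ¬ Q (i s)) ∧
      ∀ s u, s + 1 < u → u ≤ t → ¬ r (i s) (i u) := by
  classical
  have hex : ∃ (t : ℕ) (i : ℕ → V), P (i 0) ∧ Q (i t) ∧ ∀ s < t, r (i s) (i (s + 1)) := by
    obtain ⟨n, i, rfl, rfl, hi⟩ := h.exists_seq
    exact ⟨n, i, ha, hb, hi⟩
  obtain ⟨i, h0, ht, hi⟩ := Nat.find_spec hex
  have hmin := fun m (hm : m < Nat.find hex) => Nat.find_min hex hm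
  set t := Nat.find hex
  refine ⟨t, i, h0, ht, hi, fun s hs hst hP => ?_, fun s hs hQ => ?_, fun s u hsu hut hr => ?_⟩
  · refine hmin (t - s) (by omega) ⟨fun n => i (n + s), by simpa using hP, ?_, fun n hn => ?_⟩
    · simpa [Nat.sub_add_cancel hst] using ht
    · have := hi (n + s) (by omega)
      rwa [show n + s + 1 = n + 1 + s by omega] at this
  · exact hmin s hs ⟨i, h0, hQ, fun n hn => hi n (by omega)⟩
  · refine hmin (t - (u - s - 1)) (by omega)
      -- The shortcut omits the `u - s - 1` points strictly between `s` and `u`.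
      ⟨fun n => if n ≤ s then i n else i (n + (u - s - 1)), by simpa using h0, ?_, fun n hn => ?_⟩
    · simp only
      rw [if_neg (by omega), Nat.sub_add_cancel (by omega)]
      exact ht
    · simp only
      rcases lt_trichotomy n s with h | h | h
      · rw [if_pos h.le, if_pos (by omega)]
        exact hi n (by omega)
      · rw [if_pos h.le, if_neg (by omega), h, show s + 1 + (u - s - 1) = u by omega]
        exact hr
      · rw [if_neg (by omega), if_neg (by omega),
          show n + 1 + (u - s - 1) = n + (u - s - 1) + 1 by omega]
        exact hi _ (by omega)

end ShortestPath

/-! ### Uniqueness of signs for regular families with given supports -/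

section Signing

variable {E K : Type*} [Fintype K]

/-- A family of `{0, 1, -1}`-vectors such that the support of each nonzero integral combination
contains the support of a nonzero combination with entries in `{0, 1, -1}`. -/
structure IsRegularFamily (D : K → E → ℤ) : Prop where
  abs_le_one : ∀ k e, |D k e| ≤ 1
  exists_combination : ∀ w : K → ℤ, w ≠ 0 → ∃ d : K → ℤ, d ≠ 0 ∧ (∀ k, w k = 0 → d k = 0) ∧
    ∀ e, (∑ k, w k * D k e = 0 → ∑ k, d k * D k e = 0) ∧ |∑ k, d k * D k e| ≤ 1

theorem IsRegularFamily.units_mul {D : K → E → ℤ} (hD : IsRegularFamily D) (a : E → ℤˣ)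
    (b : K → ℤˣ) : IsRegularFamily fun k e => (a e : ℤ) * b k * D k e := by
  have habs : ∀ u : ℤˣ, |(u : ℤ)| = 1 := fun u => by
    rcases Int.units_eq_one_or u with rfl | rfl <;> simp
  have hsum : ∀ (w : K → ℤ) e, ∑ k, w k * ((a e : ℤ) * b k * D k e) =
      a e * ∑ k, (b k * w k) * D k e := fun w e => by
    rw [Finset.mul_sum]
    exact Finset.sum_congr rfl fun k _ => by ring
  refine ⟨fun k e => by simpa [abs_mul, habs] using hD.abs_le_one k e, fun w hw => ?_⟩
  obtain ⟨d, hd0, hdw, hd⟩ := hD.exists_combination (fun k => b k * w k) (fun h => hw (by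
    ext k
    simpa using congrFun h k))
  refine ⟨fun k => b k * d k, fun h => hd0 (by
    ext k
    simpa using congrFun h k), fun k hk => by simp [hdw k (by simp [hk])], fun e => ?_⟩
  have hb : ∀ k, (b k : ℤ) * (b k * d k) = d k := fun k => by
    rw [← mul_assoc, ← Units.val_mul, Int.units_mul_self]; simp
  simp only [hsum, hb]
  refine ⟨fun h => ?_, ?_⟩
  · rw [(hd e).1 (by simpa using h), mul_zero]
  · rw [abs_mul, habs, one_mul]
    exact (hd e).2

/-- In a regular family the incidences around a chordless cycle admit no combination which
vanishes in all rows of the cycle but one, where it has the entry `± 2`. -/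
theorem IsRegularFamily.abs_ne_two_of_cycle {D : K → E → ℤ} (hD : IsRegularFamily D) {t : ℕ}
    (ht : 0 < t) {k : ℕ → K} {i : ℕ → E} {z : ℕ → ℤ} (hk : k 0 ≠ k t)
    (hsupp : ∀ s u, s ≤ t → u ≤ t → D (k u) (i s) ≠ 0 → u = s ∨ u = s + 1 ∨ (s = t ∧ u = 0))
    (hdiag : ∀ s ≤ t, D (k s) (i s) ≠ 0) (hsucc : ∀ s < t, D (k (s + 1)) (i s) ≠ 0)
    (hz0 : z 0 = 1)
    (hz : ∀ s < t, z s * D (k s) (i s) + z (s + 1) * D (k (s + 1)) (i s) = 0) :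
    |z 0 * D (k 0) (i t) + z t * D (k t) (i t)| ≠ 2 := by
  classical
  intro h2
  have hinj : Set.InjOn k (Finset.range (t + 1)) := by
    intro u hu v hv huv
    simp only [Finset.coe_range, Set.mem_Iio] at hu hv
    wlog huv' : u < v generalizing u v
    · rcases (not_lt.1 huv').lt_or_eq with h | h
      · exact (this huv.symm hv hu h).symm
      · exact h.symm
    exfalso
    have h3 := hdiag v (by omega)
    rw [← huv] at h3
    rcases hsupp v u (by omega) (by omega) h3 with h | h | ⟨h, h'⟩
    · omega
    · omega
    · subst h h'; exact hk huv
  have hrow : ∀ (c : ℕ → ℤ), ∀ s < t, ∑ u ∈ Finset.range (t + 1), c u * D (k u) (i s) =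
      c s * D (k s) (i s) + c (s + 1) * D (k (s + 1)) (i s) := by
    intro c s hs
    refine Finset.sum_eq_add_of_mem s (s + 1) (by simp; omega) (by simp; omega) (by omega) ?_
    rintro u hu ⟨h1, h2⟩
    by_contra h
    rcases hsupp s u hs.le (by simp at hu; omega) (right_ne_zero_of_mul h) with h | h | h
    · exact h1 h
    · exact h2 h
    · omega
  have hlast : ∀ (c : ℕ → ℤ), ∑ u ∈ Finset.range (t + 1), c u * D (k u) (i t) =
      c 0 * D (k 0) (i t) + c t * D (k t) (i t) := by
    intro c
    refine Finset.sum_eq_add_of_mem 0 t (by simp) (by simp) (by omega) ?_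
    rintro u hu ⟨h1, h2⟩
    by_contra h
    simp at hu
    rcases hsupp t u le_rfl (by omega) (right_ne_zero_of_mul h) with h | h | h
    · exact h2 h
    · omega
    · exact h1 h.2
  let w : K → ℤ := ∑ u ∈ Finset.range (t + 1), Pi.single (k u) (z u)
  have hw : ∀ e, ∑ κ, w κ * D κ e = ∑ u ∈ Finset.range (t + 1), z u * D (k u) e := by
    intro e
    simp only [w, Finset.sum_apply, Finset.sum_mul]
    rw [Finset.sum_comm]
    refine Finset.sum_congr rfl fun u _ => ?_
    rw [Finset.sum_eq_single (k u)]
    · simp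
    · intro κ _ hκ
      simp [Pi.single_eq_of_ne hκ]
    · simp
  obtain ⟨d, hd0, hdw, hd⟩ := hD.exists_combination w (by
    intro h
    have := hw (i t)
    rw [hlast] at this
    rw [← this, h] at h2
    simp at h2)
  have hdk : ∀ κ, κ ∉ (Finset.range (t + 1)).image k → d κ = 0 := by
    intro κ hκ
    refine hdw κ ?_
    simp only [w, Finset.sum_apply]
    refine Finset.sum_eq_zero fun u hu => ?_
    rw [Pi.single_eq_of_ne]
    rintro rfl
    exact hκ (Finset.mem_image_of_mem _ hu)
  have hdsum : ∀ e, ∑ κ, d κ * D κ e = ∑ u ∈ Finset.range (t + 1), d (k u) * D (k u) e := by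
    intro e
    rw [← Finset.sum_image (f := fun κ => d κ * D κ e) hinj]
    symm
    refine Finset.sum_subset (Finset.subset_univ _) fun κ _ hκ => ?_
    rw [hdk κ hκ, zero_mul]
  -- Vanishing in row `i s` passes proportionality from `s` to `s + 1`. So `d` is a multiple of `z`,
  -- and its entry at `i t` is `± 2 * d (k 0)`, which the bound by `1` forces to be zero.
  have hdz : ∀ s ≤ t, d (k s) = d (k 0) * z s := by
    intro s
    induction s with
    | zero => intro _; rw [hz0, mul_one]
    | succ s ih =>
      intro hs
      have h1 := (hd (i s)).1 (by rw [hw, hrow _ s (by omega), hz s (by omega)])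
      rw [hdsum, hrow (fun u => d (k u)) s (by omega)] at h1
      rw [ih (by omega)] at h1
      have h3 := hz s (by omega)
      refine mul_right_cancel₀ (hsucc s (by omega)) ?_
      linear_combination h1 - d (k 0) * h3
  have h3 := (hd (i t)).2
  rw [hdsum, hlast (fun u => d (k u))] at h3
  rw [hdz t le_rfl, mul_assoc, show d (k 0) * D (k 0) (i t) = d (k 0) * (z 0 * D (k 0) (i t)) by
    rw [hz0, one_mul], ← mul_add, abs_mul, h2] at h3
  have h4 : d (k 0) = 0 := by
    have := abs_nonneg (d (k 0))
    exact abs_eq_zero.1 (by omega)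
  refine hd0 (funext fun κ => ?_)
  by_cases hκ : κ ∈ (Finset.range (t + 1)).image k
  · obtain ⟨u, hu, rfl⟩ := Finset.mem_image.1 hκ
    rw [hdz u (by simp at hu; omega), h4, zero_mul]; rfl
  · exact hdk κ hκ

/-- A shortest link from a coordinate where the vectors at `j` agree to one where they are opposite
closes up through `j` to a chordless cycle. Along it `D` and `D'` differ in a single sign, so one of
the two closing sums is `± 2`, against `abs_ne_two_of_cycle`. -/
theorem IsRegularFamily.not_reflTransGen {D D' : K → E → ℤ} (hD : IsRegularFamily D)
    (hD' : IsRegularFamily D') (hsupp : ∀ k e, D k e = 0 ↔ D' k e = 0) {S : Finset K} {j : K}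
    (hj : j ∉ S) (hS : ∀ k ∈ S, ∀ e, D' k e = D k e) {p q : E}
    (hp : D j p ≠ 0 ∧ D' j p = D j p) (hq : D j q ≠ 0 ∧ D' j q = -D j q) :
    ¬ Relation.ReflTransGen (fun e e' => ∃ k ∈ S, D k e ≠ 0 ∧ D k e' ≠ 0) p q := by
  intro hpq
  obtain ⟨t, i, hP, hQ, hr, hnP, hnQ, hsc⟩ := hpq.exists_shortest
    (P := fun e => D j e ≠ 0 ∧ D' j e = D j e) (Q := fun e => D j e ≠ 0 ∧ D' j e = -D j e) hp hq
  have : Nonempty K := ⟨j⟩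
  choose! κ hκS hκ1 hκ2 using hr
  -- Index `0` is `j`, and index `u + 1` is the vector joining `i u` to `i (u + 1)`.
  let k : ℕ → K := fun u => Nat.casesOn u j κ
  have hk0 : k 0 = j := rfl
  have hks : ∀ s, k (s + 1) = κ s := fun _ => rfl
  have ht : 0 < t := by
    rcases Nat.eq_zero_or_pos t with rfl | h
    · have := hP.2.symm.trans hQ.2
      have := hP.1
      omega
    · exact h
  have hunit : ∀ k e, D k e ≠ 0 → D k e = 1 ∨ D k e = -1 := fun k e h => by
    have := abs_le.1 (hD.abs_le_one k e)
    omega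
  have hunit' : ∀ k e, D' k e ≠ 0 → D' k e = 1 ∨ D' k e = -1 := fun k e h => by
    have := abs_le.1 (hD'.abs_le_one k e)
    omega
  have hPQ : ∀ e, D j e ≠ 0 → D' j e = D j e ∨ D' j e = -D j e := fun e h => by
    have h1 := hunit j e h
    have h2 := hunit' j e (fun h' => h ((hsupp j e).2 h'))
    omega
  have hpat : ∀ s u, s ≤ t → u ≤ t → D (k u) (i s) ≠ 0 →
      u = s ∨ u = s + 1 ∨ (s = t ∧ u = 0) := by
    intro s u hs hu h
    rcases u with _ | u
    · by_contra hcon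
      rcases hPQ _ h with h1 | h1
      · exact hnP s (by omega) hs ⟨h, h1⟩
      · exact hnQ s (by omega) ⟨h, h1⟩
    · by_contra hcon
      rcases lt_or_ge s u with h1 | h1
      · exact hsc s (u + 1) (by omega) (by omega) ⟨κ u, hκS u (by omega), h, hκ2 u (by omega)⟩
      · exact hsc u s (by omega) (by omega) ⟨κ u, hκS u (by omega), hκ1 u (by omega), h⟩
  have hdiag : ∀ s ≤ t, D (k s) (i s) ≠ 0 := by
    intro s hs
    rcases s with _ | s
    · exact hP.1
    · exact hκ2 s (by omega)
  have hsucc : ∀ s < t, D (k (s + 1)) (i s) ≠ 0 := fun s hs => hκ1 s hs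
  have hkt : k 0 ≠ k t := by
    obtain ⟨t', rfl⟩ := Nat.exists_eq_succ_of_ne_zero ht.ne'
    intro h
    have h' : j = κ t' := h
    exact hj (h' ▸ hκS t' (by omega))
  have heq : ∀ s u, s ≤ t → u ≤ t → ¬ (s = t ∧ u = 0) → D' (k u) (i s) = D (k u) (i s) := by
    intro s u hs hu hsu
    rcases u with _ | u
    · by_cases h0 : s = 0
      · subst h0; exact hP.2
      · by_cases h : D j (i s) = 0
        · exact ((hsupp _ _).1 h).trans h.symm
        · exact absurd (hpat s 0 hs hu h) (by omega)
    · exact hS _ (hκS u (by omega)) _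
  -- The recursion solves the row equations because nonzero entries square to `1`.
  let z : ℕ → ℤ := fun s => Nat.rec 1 (fun s zs => -zs * D (k s) (i s) * D (k (s + 1)) (i s)) s
  have hz0 : z 0 = 1 := rfl
  have hzs : ∀ s, z (s + 1) = -z s * D (k s) (i s) * D (k (s + 1)) (i s) := fun _ => rfl
  have hz : ∀ s < t, z s * D (k s) (i s) + z (s + 1) * D (k (s + 1)) (i s) = 0 := by
    intro s hs
    rw [hzs]
    rcases hunit _ _ (hsucc s hs) with h | h <;> rw [h] <;> ring
  have hzu : ∀ s ≤ t, z s = 1 ∨ z s = -1 := by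
    intro s
    induction s with
    | zero => intro _; exact Or.inl hz0
    | succ s ih =>
      intro hs
      rw [hzs]
      rcases ih (by omega) with h1 | h1 <;>
      rcases hunit _ _ (hsucc s (by omega)) with h2 | h2 <;>
      rcases hunit _ _ (hdiag s (by omega)) with h3 | h3 <;> simp [h1, h2, h3]
  have n1 := hD.abs_ne_two_of_cycle ht hkt hpat hdiag hsucc hz0 hz
  have n2 := hD'.abs_ne_two_of_cycle ht hkt
    (fun s u hs hu h => hpat s u hs hu fun h' => h ((hsupp _ _).1 h'))
    (fun s hs h => hdiag s hs ((hsupp _ _).2 h)) (fun s hs h => hsucc s hs ((hsupp _ _).2 h)) hz0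
    (fun s hs => by
      rw [heq s s hs.le hs.le (by omega), heq s (s + 1) hs.le hs (by omega)]
      exact hz s hs)
  rw [heq t t le_rfl le_rfl (by omega)] at n2
  have hQ2 : D' (k 0) (i t) = -D (k 0) (i t) := hQ.2
  rw [hQ2] at n2
  have hQ1 : D (k 0) (i t) ≠ 0 := hQ.1
  rcases hunit _ _ hQ1 with h1 | h1 <;>
  rcases hunit _ _ (hdiag t le_rfl) with h2 | h2 <;>
  rcases hzu t le_rfl with h3 | h3 <;> simp [h1, h2, h3, hz0] at n1 n2

/-- Two regular families with the same supports agree up to signs of the vectors and of the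
coordinates. -/
theorem IsRegularFamily.exists_units {D D' : K → E → ℤ} (hD : IsRegularFamily D)
    (hD' : IsRegularFamily D') (hsupp : ∀ k e, D k e = 0 ↔ D' k e = 0) :
    ∃ (a : E → ℤˣ) (b : K → ℤˣ), ∀ k e, D' k e = a e * b k * D k e := by
  classical
  suffices h : ∀ S : Finset K, ∃ (a : E → ℤˣ) (b : K → ℤˣ), ∀ k ∈ S, ∀ e,
      D' k e = a e * b k * D k e by
    obtain ⟨a, b, h⟩ := h Finset.univ
    exact ⟨a, b, fun k e => h k (Finset.mem_univ _) e⟩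
  intro S
  induction S using Finset.induction_on with
  | empty => exact ⟨1, 1, by simp⟩
  | insert j S hj ih =>
    obtain ⟨a, b, hab⟩ := ih
    let D₁ : K → E → ℤ := fun k e => (a e : ℤ) * b k * D k e
    have hD₁ : IsRegularFamily D₁ := hD.units_mul a b
    have hsupp₁ : ∀ k e, D₁ k e = 0 ↔ D' k e = 0 := fun k e => by simp [D₁, ← hsupp]
    suffices h : ∃ (a₁ : E → ℤˣ) (b₁ : K → ℤˣ), ∀ k ∈ insert j S, ∀ e,
        D' k e = a₁ e * b₁ k * D₁ k e by
      obtain ⟨a₁, b₁, h⟩ := h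
      refine ⟨a₁ * a, b₁ * b, fun k hk e => ?_⟩
      rw [h k hk e]
      simp only [D₁, Pi.mul_apply, Units.val_mul]
      ring
    let r : E → E → Prop := fun e e' => ∃ k ∈ S, D₁ k e ≠ 0 ∧ D₁ k e' ≠ 0
    -- `U` collects the coordinates linked through `S` to one where the vectors at `j` already
    -- agree. Flipping the complement of `U` corrects `j`. Each `k ∈ S` has its support inside or
    -- outside `U`, and in the latter case flipping the vector as well restores it.
    let U : E → Prop := fun e => ∃ p, (D₁ j p ≠ 0 ∧ D' j p = D₁ j p) ∧ Relation.ReflTransGen r p e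
    have hU : ∀ k ∈ S, ∀ e e', D₁ k e ≠ 0 → D₁ k e' ≠ 0 → U e → U e' := by
      rintro k hk e e' he he' ⟨p, hp, hpe⟩
      exact ⟨p, hp, hpe.tail ⟨k, hk, he, he'⟩⟩
    refine ⟨fun e => if U e then 1 else -1,
      fun k => if k = j ∨ ∃ e, U e ∧ D₁ k e ≠ 0 then 1 else -1, fun k hk e => ?_⟩
    by_cases h0 : D₁ k e = 0
    · rw [h0, mul_zero]; exact (hsupp₁ k e).1 h0
    rcases Finset.mem_insert.1 hk with rfl | hk
    · by_cases hUe : U e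
      · obtain ⟨p, hp, hpe⟩ := hUe
        have hnq := fun hq => hD₁.not_reflTransGen hD' hsupp₁ hj (fun k hk e => hab k hk e) hp
          hq hpe
        have hU' : U e := ⟨p, hp, hpe⟩
        beta_reduce
        rw [if_pos hU', if_pos (Or.inl rfl)]
        have h1 := abs_le.1 (hD₁.abs_le_one k e)
        have h2 := abs_le.1 (hD'.abs_le_one k e)
        have h3 : D' k e ≠ 0 := fun h => h0 ((hsupp₁ k e).2 h)
        have h4 : ¬ D' k e = -D₁ k e := fun h => hnq ⟨h0, h⟩
        simp only [Units.val_one, one_mul]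
        omega
      · beta_reduce
        rw [if_neg hUe, if_pos (Or.inl rfl)]
        have h1 := abs_le.1 (hD₁.abs_le_one k e)
        have h2 := abs_le.1 (hD'.abs_le_one k e)
        have h3 : D' k e ≠ 0 := fun h => h0 ((hsupp₁ k e).2 h)
        have h4 : ¬ D' k e = D₁ k e := fun h => hUe ⟨e, ⟨h0, h⟩, .refl⟩
        simp only [Units.val_one, Units.val_neg, mul_one, neg_mul, one_mul]
        omega
    · have hkj : k ≠ j := fun h => hj (h ▸ hk)
      have hkD : D' k e = D₁ k e := hab k hk e
      rw [hkD]
      beta_reduce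
      by_cases hUe : U e
      · rw [if_pos hUe, if_pos (Or.inr ⟨e, hUe, h0⟩)]; simp
      · rw [if_neg hUe, if_neg]
        · simp
        · rintro (h | ⟨e', he', h⟩)
          · exact hkj h
          · exact hUe (hU k hk e' e h h0 he')

end Signing

/-! ### Independence determines a regular lattice up to coordinate signs -/

section Uniqueness

variable {E : Type*} {L L' : AddSubgroup (E → ℤ)}

theorem FlowIndep.eq_of_maximal {B : Set E} (hB : FlowIndep L B) {x y : E → ℤ} (hx : x ∈ L)
    (hy : y ∈ L) (h : ∀ e ∉ B, x e = y e) : x = y :=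
  sub_eq_zero.1 (hB _ (sub_mem hx hy) fun e he => by simp [h e he])

/-- The lattice vectors `c k`, for `k` outside the maximal independent set `B`, which are supported
in `insert k B` and have the entry `1` at `k`. -/
structure IsFundamentalFamily (L : AddSubgroup (E → ℤ)) (B : Set E)
    (c : {e // e ∉ B} → E → ℤ) : Prop where
  mem : ∀ k, c k ∈ L
  apply_self : ∀ k : {e // e ∉ B}, c k k = 1
  apply_eq_zero : ∀ (k : {e // e ∉ B}) (e : E), e ∉ B → e ≠ k → c k e = 0
  abs_le_one : ∀ k e, |c k e| ≤ 1

theorem Int.abs_sign_le_one (a : ℤ) : |a.sign| ≤ 1 := by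
  rcases lt_trichotomy a 0 with h | h | h
  · simp [Int.sign_eq_neg_one_of_neg h]
  · simp [h]
  · simp [Int.sign_eq_one_of_pos h]

theorem IsRegularLattice.exists_isFundamentalFamily (hL : IsRegularLattice L) {B : Set E}
    (hB : Maximal (FlowIndep L) B) : ∃ c, IsFundamentalFamily L B c := by
  suffices h : ∀ k : {e // e ∉ B}, ∃ c ∈ L, c k = 1 ∧ (∀ e, e ∉ B → e ≠ k → c e = 0) ∧
      ∀ e, |c e| ≤ 1 by
    choose c h1 h2 h3 h4 using h
    exact ⟨c, h1, h2, h3, h4⟩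
  intro k
  have hk : ¬ FlowIndep L (insert (k : E) B) := fun h =>
    k.2 (hB.2 h (Set.subset_insert _ _) (Set.mem_insert _ _))
  simp only [FlowIndep, not_forall] at hk
  obtain ⟨x, hx, hxB, hx0⟩ := hk
  obtain ⟨c, hc, hc0, hcx⟩ := hL x hx hx0
  have hcB : ∀ e, e ∉ B → e ≠ k → c e = 0 := fun e he hek => by
    have := hxB e (by simp [he, hek])
    simpa [this] using hcx e
  have habs : ∀ e, |c e| ≤ 1 := fun e => by
    rcases hcx e with h | h
    · simp [h]
    · rw [h]; exact Int.abs_sign_le_one _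
  have hck : c k ≠ 0 := fun h => hc0 (hB.1 c hc fun e he => by
    by_cases hek : e = k
    · rw [hek, h]
    · exact hcB e he hek)
  have h1 := abs_le.1 (habs k)
  rcases hck.lt_or_gt with h | h
  · exact ⟨-c, neg_mem hc, by simp; omega, fun e he hek => by simp [hcB e he hek],
      fun e => by simpa using habs e⟩
  · exact ⟨c, hc, by omega, hcB, habs⟩

namespace IsFundamentalFamily

variable {B : Set E} {c : {e // e ∉ B} → E → ℤ}

theorem sum_apply [Fintype {e // e ∉ B}] (hc : IsFundamentalFamily L B c) (w : {e // e ∉ B} → ℤ)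
    (k : {e // e ∉ B}) : ∑ l, w l * c l k = w k := by
  rw [Finset.sum_eq_single k]
  · rw [hc.apply_self, mul_one]
  · intro l _ hl
    rw [hc.apply_eq_zero l k k.2 (fun h => hl (Subtype.ext h.symm)), mul_zero]
  · simp

theorem sum_mem [Fintype {e // e ∉ B}] (hc : IsFundamentalFamily L B c)
    (w : {e // e ∉ B} → ℤ) : (fun e => ∑ k, w k * c k e) ∈ L := by
  have : (fun e => ∑ k, w k * c k e) = ∑ k, w k • c k := by ext e; simp
  rw [this]
  exact _root_.sum_mem fun k _ => zsmul_mem (hc.mem k) _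

theorem eq_sum [Fintype {e // e ∉ B}] (hc : IsFundamentalFamily L B c) (hB : FlowIndep L B)
    {x : E → ℤ} (hx : x ∈ L) (e : E) : x e = ∑ k : {e // e ∉ B}, x k * c k e := by
  refine congrFun (hB.eq_of_maximal hx (hc.sum_mem fun k : {e // e ∉ B} => x k) fun e he => ?_) e
  exact (hc.sum_apply (fun k : {e // e ∉ B} => x k) ⟨e, he⟩).symm

/-- Coordinates off `B` are the coefficients in the family. A conformal vector `d` below the
combination is therefore itself a combination, with coefficients vanishing wherever those of `w` do.
-/
theorem isRegularFamily [Fintype {e // e ∉ B}] (hc : IsFundamentalFamily L B c)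
    (hB : FlowIndep L B) (hL : IsRegularLattice L) : IsRegularFamily c := by
  refine ⟨hc.abs_le_one, fun w hw => ?_⟩
  have hxw : ∀ k : {e // e ∉ B}, (fun e => ∑ k, w k * c k e) k = w k := fun k => hc.sum_apply w k
  obtain ⟨d, hd, hd0, hdx⟩ := hL _ (hc.sum_mem w) (fun h => hw (by
    ext k
    rw [← hxw, h]; rfl))
  have hdsum := fun e => hc.eq_sum hB hd e
  refine ⟨fun k => d k, fun h => hd0 ?_, fun k hk => ?_, fun e => ⟨fun he => ?_, ?_⟩⟩
  · ext e
    rw [hdsum e]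
    exact Finset.sum_eq_zero fun k _ => by rw [show d k = 0 from congrFun h k, zero_mul]
  · have := hdx k
    rw [hc.sum_apply, hk] at this
    simpa using this
  · rw [← hdsum]
    have := hdx e
    beta_reduce at this
    rw [he] at this
    simpa using this
  · rw [← hdsum]
    rcases hdx e with h | h
    · simp [h]
    · rw [h]; exact Int.abs_sign_le_one _

/-- `c k` spans the lattice vectors supported in `insert k B`, so deleting `e` destroys the
dependence exactly when `e` is in its support. Supports are thus visible to independence alone. -/
theorem apply_eq_zero_iff (hc : IsFundamentalFamily L B c) (hB : FlowIndep L B)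
    (k : {e // e ∉ B}) (e : E) : c k e = 0 ↔ ¬ FlowIndep L (insert (k : E) B \ {e}) := by
  constructor
  · intro h hind
    have h0 := hind _ (hc.mem k) fun f hf => by
      by_cases hfe : f = e
      · rw [hfe, h]
      · simp only [Set.mem_sdiff, Set.mem_insert_iff, Set.mem_singleton_iff, hfe, not_false_eq_true,
          and_true, not_or] at hf
        exact hc.apply_eq_zero k f hf.2 hf.1
    have := hc.apply_self k
    simp [h0] at this
  · intro h
    by_contra he
    refine h fun y hy hyf => ?_
    have h1 : y = y k • c k := by
      refine hB.eq_of_maximal hy (zsmul_mem (hc.mem k) _) fun f hf => ?_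
      by_cases hfk : f = k
      · simp [hfk, hc.apply_self]
      · rw [hyf f (by simp [hf, hfk])]
        simp [hc.apply_eq_zero k f hf hfk]
    have h2 : y e = 0 := hyf e (by simp)
    rw [h1] at h2
    have h3 : y k = 0 := by simpa [he] using h2
    rw [h1, h3, zero_smul]

end IsFundamentalFamily

/-- Regular lattices with the same independent sets agree up to signs of the coordinates. -/
theorem IsRegularLattice.exists_units [Finite E] (hL : IsRegularLattice L)
    (hL' : IsRegularLattice L') (h : ∀ I, FlowIndep L I ↔ FlowIndep L' I) :
    ∃ a : E → ℤˣ, ∀ x, x ∈ L ↔ (fun e => (a e : ℤ) * x e) ∈ L' := by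
  classical
  cases nonempty_fintype E
  obtain ⟨B, hB⟩ := (Set.toFinite {I | FlowIndep L I}).exists_maximal
    ⟨∅, fun x _ hx => funext fun e => hx e (by simp)⟩
  have hB : Maximal (FlowIndep L) B := hB
  have hB' : Maximal (FlowIndep L') B := by
    rwa [show FlowIndep L' = FlowIndep L from funext fun I => propext (h I).symm]
  obtain ⟨c, hc⟩ := hL.exists_isFundamentalFamily hB
  obtain ⟨c', hc'⟩ := hL'.exists_isFundamentalFamily hB'
  obtain ⟨a, b, hab⟩ := (hc.isRegularFamily hB.1 hL).exists_units (hc'.isRegularFamily hB'.1 hL')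
    (fun k e => by rw [hc.apply_eq_zero_iff hB.1, hc'.apply_eq_zero_iff hB'.1, h])
  have ha : ∀ u : ℤˣ, (u : ℤ) * u = 1 := fun u => by
    rw [← Units.val_mul, Int.units_mul_self, Units.val_one]
  refine ⟨a, fun x => ⟨fun hx => ?_, fun hx => ?_⟩⟩
  · convert hc'.sum_mem (fun k : {e // e ∉ B} => x k * b k) using 2 with e
    rw [hc.eq_sum hB.1 hx e, Finset.mul_sum]
    refine Finset.sum_congr rfl fun k _ => ?_
    rw [hab]
    linear_combination (-(a e : ℤ) * x k * c k e) * ha (b k)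
  · convert hc.sum_mem (fun k : {e // e ∉ B} => (a k * x k) * b k) using 2 with e
    have h1 := hc'.eq_sum hB'.1 hx e
    beta_reduce at h1
    rw [← one_mul (x e), ← ha (a e), mul_assoc, h1, Finset.mul_sum]
    refine Finset.sum_congr rfl fun k _ => ?_
    rw [hab]
    linear_combination ((a k : ℤ) * x k * b k * c k e) * ha (a e)

end Uniqueness

/-! ### Isometries from sign changes and from dropping vanishing coordinates -/

section Isometry

variable {E F G : Type*} [Fintype E] [Fintype F] [Fintype G]

theorem LatticesIsometric.symm {L : AddSubgroup (E → ℤ)} {L' : AddSubgroup (F → ℤ)}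
    (h : LatticesIsometric L L') : LatticesIsometric L' L := by
  obtain ⟨ψ, hψ⟩ := h
  refine ⟨ψ.symm, fun x y => ?_⟩
  rw [← hψ]
  simp

theorem LatticesIsometric.trans {L : AddSubgroup (E → ℤ)} {L' : AddSubgroup (F → ℤ)}
    {L'' : AddSubgroup (G → ℤ)} (h : LatticesIsometric L L') (h' : LatticesIsometric L' L'') :
    LatticesIsometric L L'' := by
  obtain ⟨ψ, hψ⟩ := h
  obtain ⟨ψ', hψ'⟩ := h'
  exact ⟨ψ.trans ψ', fun x y => by simp [hψ, hψ']⟩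

theorem latticesIsometric_of_units {L L' : AddSubgroup (E → ℤ)} (a : E → ℤˣ)
    (h : ∀ x, x ∈ L ↔ (fun e => (a e : ℤ) * x e) ∈ L') : LatticesIsometric L L' := by
  have ha : ∀ e, (a e : ℤ) * a e = 1 := fun e => by
    rw [← Units.val_mul, Int.units_mul_self, Units.val_one]
  refine ⟨{ toFun := fun x => ⟨fun e => a e * (x : E → ℤ) e, (h x).1 x.2⟩
            invFun := fun y => ⟨fun e => a e * (y : E → ℤ) e, (h _).2 ?_⟩
            left_inv := fun x => ?_
            right_inv := fun y => ?_
            map_add' := fun x y => ?_ }, fun x y => ?_⟩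
  · simp only [← mul_assoc, ha, one_mul]
    exact y.2
  · ext e
    simp [← mul_assoc, ha]
  · ext e
    simp [← mul_assoc, ha]
  · ext e
    simp [mul_add]
  · refine Finset.sum_congr rfl fun e _ => ?_
    show (a e * (x : E → ℤ) e) * (a e * (y : E → ℤ) e) = _
    linear_combination ((x : E → ℤ) e * (y : E → ℤ) e) * ha e

end Isometry

section Pullback

variable {E G : Type*} {L : AddSubgroup (E → ℤ)} {ι : G → E}

/-- The lattice of all pullbacks `x ∘ ι` of lattice vectors `x`. -/
def AddSubgroup.pullbackCoords (L : AddSubgroup (E → ℤ)) (ι : G → E) : AddSubgroup (G → ℤ) :=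
  L.map (LinearMap.funLeft ℤ ℤ ι).toAddMonoidHom

theorem eq_zero_of_comp_eq_zero (hL : ∀ x ∈ L, ∀ e ∉ Set.range ι, x e = 0) {x : E → ℤ}
    (hx : x ∈ L) (h : x ∘ ι = 0) : x = 0 := by
  ext e
  by_cases he : e ∈ Set.range ι
  · obtain ⟨g, rfl⟩ := he
    exact congrFun h g
  · exact hL x hx e he

theorem IsRegularLattice.pullbackCoords (h : IsRegularLattice L)
    (hL : ∀ x ∈ L, ∀ e ∉ Set.range ι, x e = 0) : IsRegularLattice (L.pullbackCoords ι) := by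
  rintro _ ⟨x, hx, rfl⟩ hx0
  obtain ⟨c, hc, hc0, hcx⟩ := h x hx (by rintro rfl; exact hx0 rfl)
  exact ⟨c ∘ ι, ⟨c, hc, rfl⟩, fun h0 => hc0 (eq_zero_of_comp_eq_zero hL hc h0), fun g => hcx (ι g)⟩

theorem flowIndep_pullbackCoords_iff (hι : Function.Injective ι)
    (hL : ∀ x ∈ L, ∀ e ∉ Set.range ι, x e = 0) (I : Set G) :
    FlowIndep (L.pullbackCoords ι) I ↔ FlowIndep L (ι '' I) := by
  constructor
  · intro h x hx hxI
    refine eq_zero_of_comp_eq_zero hL hx (h _ ⟨x, hx, rfl⟩ fun g hg => hxI _ ?_)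
    rwa [hι.mem_set_image]
  · rintro h _ ⟨x, hx, rfl⟩ hxI
    rw [h x hx fun e he => ?_]
    · rfl
    · by_cases her : e ∈ Set.range ι
      · obtain ⟨g, rfl⟩ := her
        exact hxI g fun hg => he (Set.mem_image_of_mem _ hg)
      · exact hL x hx e her

theorem latticesIsometric_pullbackCoords [Fintype E] [Fintype G] (hι : Function.Injective ι)
    (hL : ∀ x ∈ L, ∀ e ∉ Set.range ι, x e = 0) : LatticesIsometric L (L.pullbackCoords ι) := by
  let f : L →+ L.pullbackCoords ι :=
    { toFun := fun x => ⟨(x : E → ℤ) ∘ ι, x, x.2, rfl⟩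
      map_zero' := rfl
      map_add' := fun _ _ => rfl }
  refine ⟨AddEquiv.ofBijective f ⟨?_, ?_⟩, fun x y => ?_⟩
  · refine (injective_iff_map_eq_zero f).2 fun x hx => Subtype.ext ?_
    exact eq_zero_of_comp_eq_zero hL x.2 (congrArg Subtype.val hx)
  · rintro ⟨_, x, hx, rfl⟩
    exact ⟨⟨x, hx⟩, rfl⟩
  · refine Fintype.sum_of_injective ι hι _ _ (fun e he => ?_) fun g => rfl
    simp [hL x x.2 e he]

end Pullback

/-! ### Isometry of regular lattices in terms of independence -/

section RegularLattices

variable {E F : Type*} [Fintype E] [Fintype F] {L : AddSubgroup (E → ℤ)} {L' : AddSubgroup (F → ℤ)}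

/-- Two regular lattices are isometric if and only if some bijection between the coordinates which
do not vanish identically preserves independence. -/
theorem IsRegularLattice.latticesIsometric_iff (hL : IsRegularLattice L)
    (hL' : IsRegularLattice L') :
    LatticesIsometric L L' ↔
      ∃ φ : {e // ∃ x ∈ L, x e ≠ 0} ≃ {f // ∃ x ∈ L', x f ≠ 0}, ∀ I,
        FlowIndep L (Subtype.val '' I) ↔ FlowIndep L' (Subtype.val '' (φ '' I)) := by
  classical
  constructor
  · intro h
    obtain ⟨ψ, φ, hφ⟩ := h.exists_equiv hL hL'
    refine ⟨φ, fun I => ⟨fun hI y hy hyI => ?_, fun hI x hx hxI => ?_⟩⟩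
    · obtain ⟨x, hxy⟩ := ψ.surjective ⟨y, hy⟩
      have hxy' : (ψ x : F → ℤ) = y := congrArg Subtype.val hxy
      have hx : x = 0 := Subtype.ext (hI x x.2 fun e he => by
        by_contra hxe
        refine hxe ((hφ x ⟨e, x, x.2, hxe⟩).1 ?_)
        rw [hxy']
        refine hyI _ fun hmem => he ?_
        rw [Subtype.val_injective.mem_set_image, φ.injective.mem_set_image] at hmem
        exact ⟨_, hmem, rfl⟩)
      rw [← hxy', hx, map_zero]
      rfl
    · have h0 : (ψ ⟨x, hx⟩ : F → ℤ) = 0 := hI _ (ψ ⟨x, hx⟩).2 fun f hf => by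
        by_contra hne
        obtain ⟨e, he⟩ := φ.surjective ⟨f, _, (ψ ⟨x, hx⟩).2, hne⟩
        have he' : (φ e : F) = f := congrArg Subtype.val he
        refine hne ?_
        rw [← he', hφ]
        refine hxI _ fun hmem => hf ?_
        rw [Subtype.val_injective.mem_set_image] at hmem
        exact ⟨φ e, Set.mem_image_of_mem _ hmem, he'⟩
      have h1 : ψ ⟨x, hx⟩ = 0 := Subtype.ext h0
      rw [map_eq_zero_iff ψ ψ.injective] at h1
      exact congrArg Subtype.val h1
  · rintro ⟨φ, hφ⟩
    have hr : ∀ x ∈ L, ∀ e ∉ Set.range (Subtype.val : {e // ∃ x ∈ L, x e ≠ 0} → E), x e = 0 :=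
      fun x hx e he => by_contra fun h => he ⟨⟨e, x, hx, h⟩, rfl⟩
    have hr' : ∀ x ∈ L', ∀ f ∉ Set.range fun e => (φ e : F), x f = 0 :=
      fun x hx f hf => by_contra fun h => hf ⟨φ.symm ⟨f, x, hx, h⟩, by simp⟩
    have hinj : Function.Injective fun e => (φ e : F) :=
      Subtype.val_injective.comp φ.injective
    -- Both lattices are pulled back to the nonvanishing coordinates of `L`, by inclusion and by
    -- `φ`, where they have the same independent sets.
    obtain ⟨a, ha⟩ := (hL.pullbackCoords hr).exists_units (hL'.pullbackCoords hr') fun I => by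
      rw [flowIndep_pullbackCoords_iff Subtype.val_injective hr,
        flowIndep_pullbackCoords_iff hinj hr', hφ, Set.image_image]
    exact ((latticesIsometric_pullbackCoords Subtype.val_injective hr).trans
      (latticesIsometric_of_units a ha)).trans (latticesIsometric_pullbackCoords hinj hr').symm

end RegularLattices

/-! ### Coloops and the passage back to matroids -/

namespace Matroid.IsTURepresentation

variable {α : Type*} {M : Matroid α} [Fintype M.E] {r : ℕ} {A : Matrix (Fin r) M.E ℤ}

theorem indep_iff_flowIndep (h : M.IsTURepresentation A) (I : Set M.E) :
    M.Indep (Subtype.val '' I) ↔ FlowIndep (integerFlows A) I :=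
  (h.indep_iff I).trans (linearIndepOn_real_iff_flowIndep A I)

/-- The coloops are the coordinates in which all flows vanish. -/
theorem mem_coloops_iff (h : M.IsTURepresentation A) (e : M.E) :
    (e : α) ∈ M.coloops ↔ ∀ x ∈ integerFlows A, x e = 0 := by
  classical
  rw [← isColoop_iff_mem_coloops, isColoop_iff_forall_mem_isBase]
  constructor
  · intro he
    by_contra! hcon
    -- For a flow through `e` of minimal support, the support without `e` is independent. A base
    -- containing it also contains the coloop `e`, hence the whole dependent support.
    obtain ⟨x, ⟨hx, hxe⟩, hmin⟩ := exists_minimalFor_of_wellFoundedLT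
      (fun x => x ∈ integerFlows A ∧ x e ≠ 0)
      (fun x => (Finset.univ.filter fun f => x f ≠ 0).card) hcon
    have hind : FlowIndep (integerFlows A) {f | x f ≠ 0 ∧ f ≠ e} := by
      intro z hz hzI
      by_contra hz0
      obtain ⟨f, hf⟩ := Function.ne_iff.1 hz0
      have hf' : z f ≠ 0 := hf
      have hze : z e = 0 := hzI e (by simp)
      have hzx : ∀ g, x g = 0 → z g = 0 := fun g hg => hzI g (by simp [hg])
      -- This combination kills `f` but, since `z e = 0`, keeps a nonzero entry at `e`.
      have hlt : (Finset.univ.filter fun g => (z f • x - x f • z) g ≠ 0).card <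
          (Finset.univ.filter fun g => x g ≠ 0).card := by
        apply Finset.card_lt_card
        rw [Finset.ssubset_iff_of_subset]
        · refine ⟨f, ?_, ?_⟩
          · simpa using fun h0 => hf' (hzx f h0)
          · simp [mul_comm]
        · intro g
          simp only [Finset.mem_filter, Finset.mem_univ, true_and]
          intro hg h0
          exact hg (by simp [h0, hzx g h0])
      exact absurd (hmin ⟨sub_mem (zsmul_mem hx _) (zsmul_mem hz _), by simp [hze, hf', hxe]⟩
        hlt.le) (not_le.2 hlt)
    obtain ⟨B, hB, hIB⟩ := ((h.indep_iff_flowIndep _).2 hind).exists_isBase_superset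
    have hins := hB.indep.subset (Set.insert_subset (he hB) hIB)
    rw [← Set.image_insert_eq, h.indep_iff_flowIndep] at hins
    have h0 := hins x hx fun f hf => by
      by_contra hne
      by_cases hfe : f = e
      · exact hf (Or.inl hfe)
      · exact hf (Or.inr ⟨hne, hfe⟩)
    exact hxe (by rw [h0]; rfl)
  · intro he B hB
    have hBE : Subtype.val '' ((Subtype.val : M.E → α) ⁻¹' B) = B := by
      rw [Subtype.image_preimage_coe, Set.inter_eq_right]
      exact hB.subset_ground
    refine hB.mem_of_insert_indep ?_
    have hind := hB.indep
    rw [← hBE, h.indep_iff_flowIndep] at hind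
    rw [← hBE, ← Set.image_insert_eq, h.indep_iff_flowIndep]
    intro x hx hxI
    refine hind x hx fun f hf => ?_
    by_cases hfe : f = e
    · rw [hfe, he x hx]
    · exact hxI f (by simp only [Set.mem_insert_iff, not_or]; exact ⟨hfe, hf⟩)

/-- After contraction of the coloops, the ground set consists of the coordinates in which not all
flows vanish, with the same independent sets. -/
theorem exists_equiv_contractColoops (h : M.IsTURepresentation A) :
    ∃ σ : M.contractColoops.E ≃ {e : M.E // ∃ x ∈ integerFlows A, x e ≠ 0}, ∀ I,
      M.contractColoops.Indep (Subtype.val '' I) ↔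
        FlowIndep (integerFlows A) (Subtype.val '' (σ '' I)) := by
  have hmem : ∀ e (he : e ∈ M.E), e ∉ M.coloops ↔ ∃ x ∈ integerFlows A, x ⟨e, he⟩ ≠ 0 := by
    intro e he
    rw [h.mem_coloops_iff ⟨e, he⟩]
    push Not
    rfl
  refine ⟨{ toFun := fun e => ⟨⟨e, e.2.1⟩, (hmem e e.2.1).1 e.2.2⟩
            invFun := fun e => ⟨e, e.1.2, (hmem e e.1.2).2 e.2⟩
            left_inv := fun _ => rfl
            right_inv := fun _ => rfl }, fun I => ?_⟩
  change (M.contract M.coloops).Indep _ ↔ _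
  rw [← h.indep_iff_flowIndep, M.coloops_indep.contract_indep_iff,
    union_coloops_indep_iff, and_iff_right]
  · simp only [Set.image_image]
    rfl
  · rw [Set.disjoint_left]
    rintro _ ⟨e, -, rfl⟩
    exact e.2.2

end Matroid.IsTURepresentation

/-- Since the lattice of integer flows of a regular matroid is defined through a representing
totally unimodular matrix, the equivalence is asserted for every choice of such matrices. -/
theorem theorem1 {α β : Type*} (M : Matroid α) (N : Matroid β) [Fintype M.E] [Fintype N.E]
    (hM : M.IsRegular) (hN : N.IsRegular) :
    ∀ (r s : ℕ) (A : Matrix (Fin r) M.E ℤ) (B : Matrix (Fin s) N.E ℤ),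
      M.IsTURepresentation A → N.IsTURepresentation B →
        (LatticesIsometric (integerFlows A) (integerFlows B) ↔
          M.contractColoops.IsIsomorphic N.contractColoops) := by
  intro r s A B hA hB
  rw [hA.isTotallyUnimodular.isRegularLattice.latticesIsometric_iff
    hB.isTotallyUnimodular.isRegularLattice]
  obtain ⟨σ, hσ⟩ := hA.exists_equiv_contractColoops
  obtain ⟨τ, hτ⟩ := hB.exists_equiv_contractColoops
  constructor
  · rintro ⟨φ, hφ⟩
    refine ⟨(σ.trans φ).trans τ.symm, fun I => ?_⟩
    rw [hσ, hφ, hτ]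
    simp only [Set.image_image, Equiv.trans_apply, Equiv.apply_symm_apply]
  · rintro ⟨φ, hφ⟩
    refine ⟨(σ.symm.trans φ).trans τ, fun I => ?_⟩
    have := (hσ (σ.symm '' I)).symm.trans ((hφ _).trans (hτ _))
    simpa only [Set.image_image, Equiv.trans_apply, Equiv.apply_symm_apply] using this
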